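/- **Theorem (Completeness).** Let $\mathbf P$ be a countable set of proposition letters. Let $\mathbf{PL}$ be the language $\alpha ::= p\mid\bot\mid(\alpha\land\alpha)\mid(\alpha\lor\alpha)\mid(\alpha\to\alpha)$ with $p\in\mathbf P$, and let $\mathbf{DELKh}$ be the language $$\varphi ::= p\mid\bot\mid(\varphi\land\varphi)\mid(\varphi\lor\varphi)\mid(\varphi\to\varphi)\mid\mathsf K\varphi\mid\mathsf{Kh}\,\alpha\mid\Box\varphi\qquad(p\in\mathbf P,\ \alpha\in\mathbf{PL}),$$ with $\neg\varphi:=\varphi\to\bot$, $\varphi\leftrightarrow\psi:=(\varphi\to\psi)\land(\psi\to\varphi)$, $\widehat{\mathsf K}:=\neg\mathsf K\neg$, $\Diamond:=\neg\Box\neg$. *Semantics.* An epistemic model is a pair $\mathcal M=\langle W,V\rangle$ with $W\neq\emptyset$ and $V:W\to\wp(\mathbf P)$ (the epistemic relation is the total relation on $W$); a submodel is the restriction of $\mathcal M$ to a non-empty subset of $W$. The resolution space $S(\alpha)$ is given by $S(p)=\{p\}$, $S(\bot)=\{\bot\}$, $S(\alpha\lor\beta)=(S(\alpha)\times\{0\})\cup(S(\beta)\times\{1\})$,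 $S(\alpha\land\beta)=S(\alpha)\times S(\beta)$, $S(\alpha\to\beta)=S(\beta)^{S(\alpha)}$. The resolutions $R(w,\alpha)\subseteq S(\alpha)$ at $w\in W$ are given by $R(w,\bot)=\emptyset$; $R(w,p)=\{p\}$ if $p\in V(w)$ and $\emptyset$ otherwise; $R(w,\alpha\lor\beta)=(R(w,\alpha)\times\{0\})\cup(R(w,\beta)\times\{1\})$; $R(w,\alpha\land\beta)=R(w,\alpha)\times R(w,\beta)$; $R(w,\alpha\to\beta)=\{f\in S(\beta)^{S(\alpha)}: f[R(w,\alpha)]\subseteq R(w,\beta)\}$. Satisfaction $\mathcal M,w\vDash\varphi$ is defined classically for letters and $\bot,\land,\lor,\to$, and by - $\mathcal M,w\vDash\mathsf K\varphi$ iff $\mathcal M,v\vDash\varphi$ for all $v\in W$; - $\mathcal M,w\vDash\mathsf{Kh}\,\alpha$ iff there is $x\in S(\alpha)$ with $x\in R(v,\alpha)$ for all $v\in W$; - $\mathcal M,w\vDash\Box\varphi$ iff $\mathcal M',w\vDash\varphi$ for every submodel $\mathcal M'$ of $\mathcal M$ that contains $w$. *The Hilbert system $\mathsf{SDELKh}$.*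 For all $\varphi,\psi\in\mathbf{DELKh}$, $\alpha,\beta,\alpha_i\in\mathbf{PL}$, $p\in\mathbf P$, $k\in\mathbb N$, its axioms are: all instances of propositional tautologies; $\mathsf K(\varphi\to\psi)\to(\mathsf K\varphi\to\mathsf K\psi)$; $\mathsf K\varphi\to\varphi$; $\mathsf K\varphi\to\mathsf K\mathsf K\varphi$; $\neg\mathsf K\varphi\to\mathsf K\neg\mathsf K\varphi$; $\Box(\varphi\to\psi)\to(\Box\varphi\to\Box\psi)$; $\Box\varphi\to\varphi$; $\Box\varphi\to\Box\Box\varphi$; $\mathsf K\Box\varphi\to\Box\mathsf K\varphi$; $\alpha\to\Box\alpha$; $\alpha\to\Diamond\mathsf{Kh}\,\alpha$; $\mathsf{Kh}\,\alpha\to\mathsf K\alpha$; $\mathsf Kp\to\mathsf{Kh}\,p$; $\mathsf{Kh}\bot\leftrightarrow\bot$; $\mathsf{Kh}(\alpha\lor\beta)\leftrightarrow\mathsf{Kh}\,\alpha\lor\mathsf{Kh}\,\beta$; $\mathsf{Kh}(\alpha\land\beta)\leftrightarrow\mathsf{Kh}\,\alpha\land\mathsf{Kh}\,\beta$; $\mathsf{Kh}(\alpha\to\beta)\leftrightarrow\mathsf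 K\Box(\mathsf{Kh}\,\alpha\to\mathsf{Kh}\,\beta)$; $\mathsf{Kh}\,\alpha\to\mathsf K\mathsf{Kh}\,\alpha$; $\neg\mathsf{Kh}\,\alpha\to\mathsf K\neg\mathsf{Kh}\,\alpha$; and $$\alpha\land\bigwedge_{1\le i\le k}\widehat{\mathsf K}(\alpha\land\alpha_i)\to\Diamond\Bigl(\mathsf K\alpha\land\bigwedge_{1\le i\le k}\widehat{\mathsf K}\alpha_i\Bigr).$$ Its rules are modus ponens and necessitation for $\mathsf K$ and for $\Box$ (from $\vdash\varphi$ infer $\vdash\mathsf K\varphi$ and $\vdash\Box\varphi$). *Claim.* $\mathsf{SDELKh}$ is complete over the class of all epistemic models: every $\varphi\in\mathbf{DELKh}$ with $\mathcal M,w\vDash\varphi$ for all epistemic models $\mathcal M$ and all worlds $w$ of $\mathcal M$ is provable in $\mathsf{SDELKh}$. -/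

import Mathlib

universe u v

namespace InqKh

/-- The propositional language `PL` over a set `P` of proposition letters. -/
inductive PForm (P : Type v) : Type v where
  | atom (p : P) : PForm P
  | bot : PForm P
  | and (α β : PForm P) : PForm P
  | or (α β : PForm P) : PForm P
  | imp (α β : PForm P) : PForm P

/-- The dynamic epistemic language of knowing how, `DELKh`. The know-how operator `kh` applies
to propositional formulas only. -/
inductive Form (P : Type v) : Type v where
  | atom (p : P) : Form P
  | bot : Form P
  | and (φ ψ : Form P) : Form P
  | or (φ ψ : Form P) : Form P
  | imp (φ ψ : Form P) : Form P
  | know (φ : Form P) : Form P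
  | kh (α : PForm P) : Form P
  | box (φ : Form P) : Form P

/-- Every propositional formula is a formula of the full language. -/
def PForm.toForm {P : Type v} : PForm P → Form P
  | .atom p => .atom p
  | .bot => .bot
  | .and α β => .and α.toForm β.toForm
  | .or α β => .or α.toForm β.toForm
  | .imp α β => .imp α.toForm β.toForm

namespace Form

variable {P : Type v}

/-- `¬φ` abbreviates `φ → ⊥`. -/
def neg (φ : Form P) : Form P := .imp φ .bot

/-- `⊤` abbreviates `¬⊥`. -/
def top : Form P := neg .bot

/-- `φ ↔ ψ` abbreviates `(φ → ψ) ∧ (ψ → φ)`. -/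
def iff (φ ψ : Form P) : Form P := .and (.imp φ ψ) (.imp ψ φ)

/-- `K̂φ` abbreviates `¬K¬φ`. -/
def hatK (φ : Form P) : Form P := neg (.know (neg φ))

/-- `◇φ` abbreviates `¬□¬φ`. -/
def dia (φ : Form P) : Form P := neg (.box (neg φ))

/-- The conjunction of a finite list of formulas; the empty conjunction is `⊤`. -/
def bigAnd : List (Form P) → Form P
  | [] => top
  | φ :: l => .and φ (bigAnd l)

/-- The truth value of a formula under an assignment `v` of truth values to the formulas that
are not built by a propositional connective (letters, `Kφ`, `Kh α`, `□φ`). -/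
def propEval (v : Form P → Prop) : Form P → Prop
  | .atom p => v (.atom p)
  | .bot => False
  | .and φ ψ => propEval v φ ∧ propEval v ψ
  | .or φ ψ => propEval v φ ∨ propEval v ψ
  | .imp φ ψ => propEval v φ → propEval v ψ
  | .know φ => v (.know φ)
  | .kh α => v (.kh α)
  | .box φ => v (.box φ)

/-- (Instances of) propositional tautologies in the full language. -/
def IsTautology (φ : Form P) : Prop := ∀ v : Form P → Prop, propEval v φ

end Form

/-- An epistemic (information) model: a non-empty set of worlds with a valuation. The epistemic
relation is the total relation and is left implicit. -/
structure Model (P : Type v) : Type (max (u + 1) v) where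
  World : Type u
  nonempty : Nonempty World
  val : World → Set P

/-- The submodel of `M` whose set of worlds is the non-empty set `s`. -/
abbrev Model.restrict {P : Type v} (M : Model.{u, v} P) (s : Set M.World) (hs : s.Nonempty) :
    Model.{u, v} P where
  World := s
  nonempty := hs.to_subtype
  val := fun w => M.val w.1

/-- The resolution space `S(α)`: singletons for letters and `⊥`, disjoint union for `∨`,
Cartesian product for `∧`, function space for `→`. -/
@[reducible]
def PForm.ResSpace {P : Type v} : PForm P → Type v
  | .atom p => ({p} : Set P)
  | .bot => PUnit
  | .and α β => α.ResSpace × β.ResSpace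
  | .or α β => α.ResSpace ⊕ β.ResSpace
  | .imp α β => α.ResSpace → β.ResSpace

/-- The set `R(w, α) ⊆ S(α)` of actual resolutions of `α` at the world `w`. -/
def Model.res {P : Type v} (M : Model.{u, v} P) (w : M.World) : (α : PForm P) → Set α.ResSpace
  | .atom p => {_x : ({p} : Set P) | p ∈ M.val w}
  | .bot => (∅ : Set PUnit)
  | .and α β => M.res w α ×ˢ M.res w β
  | .or α β => Sum.inl '' M.res w α ∪ Sum.inr '' M.res w β
  | .imp α β => {f : α.ResSpace → β.ResSpace | f '' M.res w α ⊆ M.res w β}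

/-- Satisfaction of a formula at a pointed model. `□` quantifies over all submodels that contain
the current world. -/
def Sat {P : Type v} : (M : Model.{u, v} P) → M.World → Form P → Prop
  | M, w, .atom p => p ∈ M.val w
  | _, _, .bot => False
  | M, w, .and φ ψ => Sat M w φ ∧ Sat M w ψ
  | M, w, .or φ ψ => Sat M w φ ∨ Sat M w ψ
  | M, w, .imp φ ψ => Sat M w φ → Sat M w ψ
  | M, _, .know φ => ∀ v : M.World, Sat M v φ
  | M, _, .kh α => ∃ x : α.ResSpace, ∀ v : M.World, x ∈ M.res v α
  | M, w, .box φ => ∀ (s : Set M.World) (hw : w ∈ s), Sat (M.restrict s (Set.nonempty_of_mem hw)) ⟨w, hw⟩ φ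

/-- `φ` is valid: it holds at every world of every epistemic model. -/
def Valid {P : Type v} (φ : Form P) : Prop :=
  ∀ (M : Model.{u, v} P) (w : M.World), Sat M w φ

open Form in
/-- Provability in the Hilbert system `SDELKh`. -/
inductive Provable {P : Type v} : Form P → Prop
  | taut (φ : Form P) (h : IsTautology φ) : Provable φ
  | distK (φ ψ : Form P) : Provable (.imp (.know (.imp φ ψ)) (.imp (.know φ) (.know ψ)))
  | tK (φ : Form P) : Provable (.imp (.know φ) φ)
  | fourK (φ : Form P) : Provable (.imp (.know φ) (.know (.know φ)))
  | fiveK (φ : Form P) : Provable (.imp (neg (.know φ)) (.know (neg (.know φ))))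
  | distBox (φ ψ : Form P) : Provable (.imp (.box (.imp φ ψ)) (.imp (.box φ) (.box ψ)))
  | tBox (φ : Form P) : Provable (.imp (.box φ) φ)
  | fourBox (φ : Form P) : Provable (.imp (.box φ) (.box (.box φ)))
  | pr (φ : Form P) : Provable (.imp (.know (.box φ)) (.box (.know φ)))
  | per (α : PForm P) : Provable (.imp α.toForm (.box α.toForm))
  | ver (α : PForm P) : Provable (.imp α.toForm (dia (.kh α)))
  | khK (α : PForm P) : Provable (.imp (.kh α) (.know α.toForm))
  | kKhp (p : P) : Provable (.imp (.know (.atom p)) (.kh (.atom p)))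
  | khBot : Provable (iff (.kh .bot) .bot)
  | khOr (α β : PForm P) : Provable (iff (.kh (.or α β)) (.or (.kh α) (.kh β)))
  | khAnd (α β : PForm P) : Provable (iff (.kh (.and α β)) (.and (.kh α) (.kh β)))
  | khImp (α β : PForm P) :
      Provable (iff (.kh (.imp α β)) (.know (.box (.imp (.kh α) (.kh β)))))
  | fourKh (α : PForm P) : Provable (.imp (.kh α) (.know (.kh α)))
  | fiveKh (α : PForm P) : Provable (.imp (neg (.kh α)) (.know (neg (.kh α))))
  /-- `α ∧ ⋀_{1 ≤ i ≤ k} K̂(α ∧ αᵢ) → ◇(Kα ∧ ⋀_{1 ≤ i ≤ k} K̂αᵢ)`, with `l = [α₁, …, α_k]`. -/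
  | eu (α : PForm P) (l : List (PForm P)) :
      Provable (.imp
        (.and α.toForm (bigAnd (l.map fun β => hatK (.and α.toForm β.toForm))))
        (dia (.and (.know α.toForm) (bigAnd (l.map fun β => hatK β.toForm)))))
  | mp (φ ψ : Form P) (h₁ : Provable φ) (h₂ : Provable (.imp φ ψ)) : Provable ψ
  | necK (φ : Form P) (h : Provable φ) : Provable (.know φ)
  | necBox (φ : Form P) (h : Provable φ) : Provable (.box φ)

end InqKh

namespace InqKh

open Form

/-! Fix the finite set `Q` of letters of `φ`. Up to truth of formulas over `Q`, a pointed model is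
given by the valuation of `Q` at its point together with the set of valuations realised in it, and a
submodel just shrinks that set while keeping the actual one. A complete theory carries the same
data: its `trace`, and the traces of its `K`-successors (`possibleTypes`). So no canonical model is
needed: the truth lemma compares each complete theory with every pointed model having the same data.

For `K`, axioms 4 and 5 make the data constant along successors. For `□`, `per` and `pr` show that
successors keep the trace and lose possible types, while `eu` realises every such loss
(`IsComplete.exists_boxRel`). The operator `Kh` is reduced to these by its recursion axioms, which
are matched by equivalences in the resolution semantics. An unprovable formula is missing from some
complete theory by Lindenbaum's lemma, and the possible types of that theory form a countermodel. -/

/-- A set of formulas containing all theorems and closed under modus ponens. -/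
structure IsTheory {P : Type v} (Γ : Set (Form P)) : Prop where
  thm : ∀ {φ}, Provable φ → φ ∈ Γ
  mp : ∀ {φ ψ}, .imp φ ψ ∈ Γ → φ ∈ Γ → ψ ∈ Γ

/-- A theory that contains exactly one of each formula and its negation. -/
structure IsComplete {P : Type v} (Γ : Set (Form P)) : Prop extends IsTheory Γ where
  mem_neg : ∀ φ, neg φ ∈ Γ ↔ φ ∉ Γ

/-! ### Complete theories and the canonical relations -/

section Theories

variable {P : Type v} {Γ : Set (Form P)}

theorem isTheory_provable : IsTheory {φ : Form P | Provable φ} :=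
  ⟨fun h => h, fun h h' => .mp _ _ h' h⟩

theorem IsTheory.taut (hΓ : IsTheory Γ) {φ : Form P} (h : IsTautology φ) : φ ∈ Γ :=
  hΓ.thm (.taut φ h)

/-- The consequences of `ψ` over a theory form a theory. -/
theorem IsTheory.adjoin (hΓ : IsTheory Γ) (ψ : Form P) : IsTheory {θ | .imp ψ θ ∈ Γ} where
  thm {θ} h := hΓ.mp (hΓ.taut (φ := .imp θ (.imp ψ θ)) (fun v => by simp only [propEval]; tauto))
    (hΓ.thm h)
  mp {θ η} h h' := hΓ.mp (hΓ.mp (hΓ.taut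
    (φ := .imp (.imp ψ (.imp θ η)) (.imp (.imp ψ θ) (.imp ψ η)))
    (fun v => by simp only [propEval]; tauto)) h) h'

/-- Lindenbaum's lemma. -/
theorem IsTheory.exists_isComplete (hΓ : IsTheory Γ) {φ : Form P} (hφ : φ ∉ Γ) :
    ∃ Δ, Γ ⊆ Δ ∧ IsComplete Δ ∧ φ ∉ Δ := by
  obtain ⟨Δ, hΓΔ, hmax⟩ := zorn_subset_nonempty {Δ | IsTheory Δ ∧ φ ∉ Δ} (fun c hc hchain hne => by
    refine ⟨⋃₀ c, ⟨⟨fun h => ?_, fun {θ η} h h' => ?_⟩, ?_⟩, fun s hs => Set.subset_sUnion_of_mem hs⟩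
    · obtain ⟨s, hs⟩ := hne
      exact ⟨s, hs, (hc hs).1.thm h⟩
    · obtain ⟨s, hs, h⟩ := h
      obtain ⟨t, ht, h'⟩ := h'
      rcases hchain.total hs ht with hst | hts
      · exact ⟨t, ht, (hc ht).1.mp (hst h) h'⟩
      · exact ⟨s, hs, (hc hs).1.mp h (hts h')⟩
    · rintro ⟨s, hs, h⟩
      exact (hc hs).2 h) Γ ⟨hΓ, hφ⟩
  obtain ⟨hΔ, hφΔ⟩ := hmax.prop
  -- If `ψ → φ` were missing, the consequences of `ψ` over `Δ` would be a theory omitting `φ`, so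
  -- maximality would put `ψ` in `Δ`.
  have key : ∀ ψ, ψ ∉ Δ → .imp ψ φ ∈ Δ := by
    intro ψ hψ
    by_contra hcon
    refine hψ (hmax.le_of_ge (y := {θ | Form.imp ψ θ ∈ Δ}) ⟨hΔ.adjoin ψ, hcon⟩ (fun θ hθ => ?_) ?_)
    · exact hΔ.mp (hΔ.taut (φ := .imp θ (.imp ψ θ)) (fun v => by simp only [propEval]; tauto)) hθ
    · exact hΔ.taut (φ := .imp ψ ψ) (fun v => by simp only [propEval]; tauto)
  refine ⟨Δ, hΓΔ, ⟨hΔ, fun ψ => ⟨fun h h' => hφΔ ?_, fun h => ?_⟩⟩, hφΔ⟩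
  · exact hΔ.mp (hΔ.taut (φ := .imp .bot φ) (fun v => by simp only [propEval]; tauto)) (hΔ.mp h h')
  · by_contra h'
    refine hφΔ (hΔ.mp (hΔ.mp (hΔ.taut (φ := .imp (.imp ψ φ) (.imp (.imp (neg ψ) φ) φ))
      (fun v => by simp only [propEval, neg]; tauto)) (key _ h)) (key _ h'))

variable {φ ψ : Form P}

theorem IsTheory.mem_of_mem (hΓ : IsTheory Γ) (h : Provable (.imp φ ψ)) (hφ : φ ∈ Γ) : ψ ∈ Γ :=
  hΓ.mp (hΓ.thm h) hφ

theorem IsTheory.mem_and (hΓ : IsTheory Γ) : Form.and φ ψ ∈ Γ ↔ φ ∈ Γ ∧ ψ ∈ Γ := by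
  refine ⟨fun h => ⟨?_, ?_⟩, fun h => ?_⟩
  · exact hΓ.mem_of_mem (.taut _ fun v => by simp only [propEval]; tauto) h
  · exact hΓ.mem_of_mem (.taut _ fun v => by simp only [propEval]; tauto) h
  · exact hΓ.mp (hΓ.mem_of_mem (.taut (.imp φ (.imp ψ (.and φ ψ)))
      fun v => by simp only [propEval]; tauto) h.1) h.2

theorem IsTheory.mem_congr (hΓ : IsTheory Γ) (h : Provable (iff φ ψ)) : φ ∈ Γ ↔ ψ ∈ Γ :=
  have h' := hΓ.mem_and.1 (hΓ.thm h)
  ⟨hΓ.mp h'.1, hΓ.mp h'.2⟩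

theorem IsComplete.bot_notMem (hΓ : IsComplete Γ) : Form.bot ∉ Γ :=
  (hΓ.mem_neg _).1 (hΓ.taut fun v => by simp only [propEval, neg]; tauto)

theorem IsComplete.mem_imp (hΓ : IsComplete Γ) : Form.imp φ ψ ∈ Γ ↔ (φ ∈ Γ → ψ ∈ Γ) := by
  refine ⟨fun h => hΓ.mp h, fun h => ?_⟩
  by_cases hφ : φ ∈ Γ
  · exact hΓ.mem_of_mem (.taut _ fun v => by simp only [propEval]; tauto) (h hφ)
  · exact hΓ.mem_of_mem (.taut _ fun v => by simp only [propEval, neg]; tauto)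
      ((hΓ.mem_neg φ).2 hφ)

theorem IsComplete.mem_or (hΓ : IsComplete Γ) : Form.or φ ψ ∈ Γ ↔ φ ∈ Γ ∨ ψ ∈ Γ := by
  refine ⟨fun h => ?_, fun h => h.elim (fun h => ?_) fun h => ?_⟩
  · by_contra! hcon
    exact hcon.2 (hΓ.mp (hΓ.mem_of_mem (.taut (.imp (neg φ) (.imp (.or φ ψ) ψ))
      fun v => by simp only [propEval, neg]; tauto) ((hΓ.mem_neg φ).2 hcon.1)) h)
  · exact hΓ.mem_of_mem (.taut _ fun v => by simp only [propEval]; tauto) h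
  · exact hΓ.mem_of_mem (.taut _ fun v => by simp only [propEval]; tauto) h

theorem IsComplete.mem_bigAnd (hΓ : IsComplete Γ) (l : List (Form P)) :
    bigAnd l ∈ Γ ↔ ∀ φ ∈ l, φ ∈ Γ := by
  induction l with
  | nil =>
    simpa [bigAnd, top, hΓ.mem_neg] using hΓ.bot_notMem
  | cons φ l ih => simp [bigAnd, hΓ.mem_and, ih]

theorem IsComplete.mem_hatK (hΓ : IsComplete Γ) : hatK φ ∈ Γ ↔ .know (neg φ) ∉ Γ :=
  hΓ.mem_neg _

theorem IsComplete.mem_dia (hΓ : IsComplete Γ) : dia φ ∈ Γ ↔ .box (neg φ) ∉ Γ :=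
  hΓ.mem_neg _

theorem Provable.know_mono (h : Provable (.imp φ ψ)) : Provable (.imp (.know φ) (.know ψ)) :=
  .mp _ _ (.necK _ h) (.distK φ ψ)

/-- A formula that belongs to every complete theory is provable. -/
theorem provable_of_forall_mem (h : ∀ Δ : Set (Form P), IsComplete Δ → φ ∈ Δ) : Provable φ := by
  by_contra hφ
  obtain ⟨Δ, -, hΔ, hφΔ⟩ := isTheory_provable.exists_isComplete hφ
  exact hφΔ (h Δ hΔ)

/-- The canonical accessibility relation of `K`. -/
def KRel (Γ Δ : Set (Form P)) : Prop := ∀ φ, .know φ ∈ Γ → φ ∈ Δ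

/-- The canonical accessibility relation of `□`. -/
def BoxRel (Γ Δ : Set (Form P)) : Prop := ∀ φ, .box φ ∈ Γ → φ ∈ Δ

theorem IsTheory.know (hΓ : IsTheory Γ) : IsTheory {φ | .know φ ∈ Γ} where
  thm h := hΓ.thm (.necK _ h)
  mp h h' := hΓ.mp (hΓ.mem_of_mem (.distK _ _) h) h'

theorem IsTheory.box (hΓ : IsTheory Γ) : IsTheory {φ | .box φ ∈ Γ} where
  thm h := hΓ.thm (.necBox _ h)
  mp h h' := hΓ.mp (hΓ.mem_of_mem (.distBox _ _) h) h'

theorem IsTheory.know_mem_iff (hΓ : IsTheory Γ) :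
    .know φ ∈ Γ ↔ ∀ Δ, IsComplete Δ → KRel Γ Δ → φ ∈ Δ := by
  refine ⟨fun h Δ _ hR => hR φ h, fun h => ?_⟩
  by_contra hφ
  obtain ⟨Δ, hR, hΔ, hφΔ⟩ := hΓ.know.exists_isComplete hφ
  exact hφΔ (h Δ hΔ fun ψ hψ => hR hψ)

theorem IsTheory.box_mem_iff (hΓ : IsTheory Γ) :
    .box φ ∈ Γ ↔ ∀ Δ, IsComplete Δ → BoxRel Γ Δ → φ ∈ Δ := by
  refine ⟨fun h Δ _ hR => hR φ h, fun h => ?_⟩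
  by_contra hφ
  obtain ⟨Δ, hR, hΔ, hφΔ⟩ := hΓ.box.exists_isComplete hφ
  exact hφΔ (h Δ hΔ fun ψ hψ => hR hψ)

theorem IsComplete.hatK_mem_iff (hΓ : IsComplete Γ) :
    hatK φ ∈ Γ ↔ ∃ Δ, IsComplete Δ ∧ KRel Γ Δ ∧ φ ∈ Δ := by
  rw [hΓ.mem_hatK, hΓ.know_mem_iff]
  push Not
  refine exists_congr fun Δ => ⟨fun ⟨h, h', h''⟩ => ⟨h, h', ?_⟩, fun ⟨h, h', h''⟩ => ⟨h, h', ?_⟩⟩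
  · by_contra hcon
    exact h'' ((h.mem_neg φ).2 hcon)
  · exact fun hcon => (h.mem_neg φ).1 hcon h''

theorem IsComplete.dia_mem_iff (hΓ : IsComplete Γ) :
    dia φ ∈ Γ ↔ ∃ Δ, IsComplete Δ ∧ BoxRel Γ Δ ∧ φ ∈ Δ := by
  rw [hΓ.mem_dia, hΓ.box_mem_iff]
  push Not
  refine exists_congr fun Δ => ⟨fun ⟨h, h', h''⟩ => ⟨h, h', ?_⟩, fun ⟨h, h', h''⟩ => ⟨h, h', ?_⟩⟩
  · by_contra hcon
    exact h'' ((h.mem_neg φ).2 hcon)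
  · exact fun hcon => (h.mem_neg φ).1 hcon h''

/-- Axiom 4 carries `Kφ` forward and axiom 5 carries `¬Kφ` forward. -/
theorem KRel.know_mem_iff {Δ : Set (Form P)} (hR : KRel Γ Δ) (hΓ : IsComplete Γ)
    (hΔ : IsComplete Δ) : .know φ ∈ Δ ↔ .know φ ∈ Γ := by
  refine ⟨fun h => ?_, fun h => hR _ (hΓ.mem_of_mem (.fourK φ) h)⟩
  by_contra h'
  exact (hΔ.mem_neg _).1 (hR _ (hΓ.mem_of_mem (.fiveK φ) ((hΓ.mem_neg _).2 h'))) h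

theorem KRel.refl (hΓ : IsTheory Γ) : KRel Γ Γ := fun φ => hΓ.mem_of_mem (.tK φ)

end Theories

/-! ### Valuations of finitely many letters -/

section Types

variable {P : Type v}

/-- The letters of a propositional formula. -/
def PForm.letters : PForm P → Set P
  | .atom p => {p}
  | .bot => ∅
  | .and α β | .or α β | .imp α β => α.letters ∪ β.letters

/-- The letters of a formula. -/
def Form.letters : Form P → Set P
  | .atom p => {p}
  | .bot => ∅
  | .and φ ψ | .or φ ψ | .imp φ ψ => φ.letters ∪ ψ.letters
  | .know φ | .box φ => φ.letters
  | .kh α => α.letters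

theorem PForm.finite_letters (α : PForm P) : α.letters.Finite := by
  induction α <;> simp_all [PForm.letters]

theorem Form.finite_letters (φ : Form P) : φ.letters.Finite := by
  induction φ <;> simp_all [Form.letters, PForm.finite_letters]

/-- Conjunction of a list of propositional formulas. -/
def PForm.conj : List (PForm P) → PForm P
  | [] => .imp .bot .bot
  | α :: l => .and α (conj l)

/-- Disjunction of a list of propositional formulas. -/
def PForm.disj : List (PForm P) → PForm P
  | [] => .bot
  | α :: l => .or α (disj l)

open Classical in
/-- The conjunction of literals over the letters in `Q` that describes the valuation `t`. -/
noncomputable def typeForm (Q : Finset P) (t : Set P) : PForm P :=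
  PForm.conj (Q.toList.map fun p => if p ∈ t then .atom p else .imp (.atom p) .bot)

/-- The letters of `Q` that belong to a set of formulas. -/
def trace (Q : Finset P) (Γ : Set (Form P)) : Set P := {p | p ∈ Q ∧ .atom p ∈ Γ}

/-- The letters of `Q` that are true at a world. -/
def Model.trace (Q : Finset P) (M : Model.{u, v} P) (w : M.World) : Set P :=
  {p | p ∈ Q ∧ p ∈ M.val w}

/-- The valuations of the letters in `Q` considered possible by a set of formulas. -/
def possibleTypes (Q : Finset P) (Γ : Set (Form P)) : Set (Set P) :=
  {t | t ⊆ Q ∧ hatK (typeForm Q t).toForm ∈ Γ}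

variable {Q : Finset P} {Γ Δ : Set (Form P)}

theorem IsComplete.mem_conj (hΓ : IsComplete Γ) (l : List (PForm P)) :
    (PForm.conj l).toForm ∈ Γ ↔ ∀ α ∈ l, α.toForm ∈ Γ := by
  induction l with
  | nil => simp [PForm.conj, PForm.toForm, hΓ.mem_imp]
  | cons α l ih => simp [PForm.conj, PForm.toForm, hΓ.mem_and, ih]

theorem IsComplete.mem_disj (hΓ : IsComplete Γ) (l : List (PForm P)) :
    (PForm.disj l).toForm ∈ Γ ↔ ∃ α ∈ l, α.toForm ∈ Γ := by
  induction l with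
  | nil => simp [PForm.disj, PForm.toForm, hΓ.bot_notMem]
  | cons α l ih => simp [PForm.disj, PForm.toForm, hΓ.mem_or, ih]

open Classical in
theorem IsComplete.typeForm_mem_iff (hΓ : IsComplete Γ) {t : Set P} (ht : t ⊆ Q) :
    (typeForm Q t).toForm ∈ Γ ↔ trace Q Γ = t := by
  rw [typeForm, hΓ.mem_conj]
  simp only [List.mem_map, Finset.mem_toList, forall_exists_index, and_imp,
    forall_apply_eq_imp_iff₂]
  have key : ∀ p, (if p ∈ t then PForm.atom p else .imp (.atom p) .bot).toForm ∈ Γ ↔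
      (.atom p ∈ Γ ↔ p ∈ t) := by
    intro p
    split_ifs with hp <;> simp [PForm.toForm, hΓ.mem_imp, hΓ.bot_notMem, hp]
  simp only [key, trace, Set.ext_iff, Set.mem_ofPred_eq]
  exact ⟨fun h p => ⟨fun hp => (h p hp.1).1 hp.2, fun hp => ⟨ht hp, (h p (ht hp)).2 hp⟩⟩,
    fun h p hp => ⟨fun h' => (h p).1 ⟨hp, h'⟩, fun h' => ((h p).2 h').2⟩⟩

theorem trace_subset : trace Q Γ ⊆ Q := fun _ hp => hp.1

theorem IsComplete.mem_possibleTypes (hΓ : IsComplete Γ) {t : Set P} :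
    t ∈ possibleTypes Q Γ ↔ ∃ Δ, IsComplete Δ ∧ KRel Γ Δ ∧ trace Q Δ = t := by
  constructor
  · rintro ⟨ht, h⟩
    obtain ⟨Δ, hΔ, hR, h⟩ := hΓ.hatK_mem_iff.1 h
    exact ⟨Δ, hΔ, hR, (hΔ.typeForm_mem_iff ht).1 h⟩
  · rintro ⟨Δ, hΔ, hR, rfl⟩
    exact ⟨trace_subset, hΓ.hatK_mem_iff.2 ⟨Δ, hΔ, hR, (hΔ.typeForm_mem_iff trace_subset).2 rfl⟩⟩

theorem finite_possibleTypes : (possibleTypes Q Γ).Finite :=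
  Q.finite_toSet.powerset.subset fun _ ht => ht.1

theorem IsComplete.trace_mem_possibleTypes (hΓ : IsComplete Γ) :
    trace Q Γ ∈ possibleTypes Q Γ :=
  hΓ.mem_possibleTypes.2 ⟨Γ, hΓ, .refl hΓ.toIsTheory, rfl⟩

theorem KRel.possibleTypes_eq (hR : KRel Γ Δ) (hΓ : IsComplete Γ) (hΔ : IsComplete Δ) :
    possibleTypes Q Δ = possibleTypes Q Γ := by
  ext t
  simp only [possibleTypes, Set.mem_ofPred_eq, hΓ.mem_hatK, hΔ.mem_hatK, hR.know_mem_iff hΓ hΔ]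

/-- Propositional formulas are preserved along the canonical relation of `□`. -/
theorem BoxRel.mem_toForm (hR : BoxRel Γ Δ) (hΓ : IsComplete Γ) {α : PForm P}
    (h : α.toForm ∈ Γ) : α.toForm ∈ Δ :=
  hR _ (hΓ.mem_of_mem (.per α) h)

theorem BoxRel.trace_eq (hR : BoxRel Γ Δ) (hΓ : IsComplete Γ) (hΔ : IsComplete Δ) :
    trace Q Δ = trace Q Γ :=
  (hΔ.typeForm_mem_iff trace_subset).1
    (hR.mem_toForm hΓ ((hΓ.typeForm_mem_iff trace_subset).2 rfl))

/-- If `Γ` excludes a type, so does `Δ`: the negated type is propositional, so `per` under `K` gives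
`K□` of it, and `pr` turns this into `□K`. -/
theorem BoxRel.possibleTypes_subset (hR : BoxRel Γ Δ) (hΓ : IsComplete Γ) (hΔ : IsComplete Δ) :
    possibleTypes Q Δ ⊆ possibleTypes Q Γ := by
  rintro t ⟨ht, h⟩
  refine ⟨ht, hΓ.mem_hatK.2 fun hK => hΔ.mem_hatK.1 h (hR _ ?_)⟩
  exact hΓ.mem_of_mem (.pr _) (hΓ.mem_of_mem
    (Provable.know_mono (.per (.imp (typeForm Q t) .bot))) hK)

/-- Every set of possible valuations that contains the actual one is the set of possible
valuations of some `□`-successor. -/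
theorem IsComplete.exists_boxRel (hΓ : IsComplete Γ) {T : Set (Set P)}
    (hT : T ⊆ possibleTypes Q Γ) (hmem : trace Q Γ ∈ T) :
    ∃ Δ, IsComplete Δ ∧ BoxRel Γ Δ ∧ possibleTypes Q Δ = T := by
  obtain ⟨F, rfl⟩ := (finite_possibleTypes.subset hT).exists_finset_coe
  set l : List (PForm P) := F.toList.map (typeForm Q) with hl
  have hlmem : ∀ α, α ∈ l ↔ ∃ t ∈ F, typeForm Q t = α := by simp [hl]
  have hdisj : ∀ {Δ : Set (Form P)}, IsComplete Δ →
      ((PForm.disj l).toForm ∈ Δ ↔ trace Q Δ ∈ F) := by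
    intro Δ hΔ
    rw [hΔ.mem_disj]
    constructor
    · rintro ⟨α, hα, h⟩
      obtain ⟨t, ht, rfl⟩ := (hlmem α).1 hα
      rwa [(hΔ.typeForm_mem_iff (hT ht).1).1 h]
    · exact fun h => ⟨_, (hlmem _).2 ⟨_, h, rfl⟩, (hΔ.typeForm_mem_iff trace_subset).2 rfl⟩
  -- In `eu`, `α` is the disjunction of the types in `F` and the `αᵢ` are these types: `Kα` will
  -- exclude all other types, and the `K̂αᵢ` will keep each of these.
  have hdia := hΓ.mem_of_mem (.eu (PForm.disj l) l) (hΓ.mem_and.2 ⟨(hdisj hΓ).2 hmem, by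
    rw [hΓ.mem_bigAnd]
    simp only [List.mem_map, forall_exists_index, and_imp, forall_apply_eq_imp_iff₂, hlmem]
    intro t ht
    obtain ⟨Δ, hΔ, hR, rfl⟩ := hΓ.mem_possibleTypes.1 (hT ht)
    exact hΓ.hatK_mem_iff.2 ⟨Δ, hΔ, hR, hΔ.mem_and.2
      ⟨(hdisj hΔ).2 ht, (hΔ.typeForm_mem_iff trace_subset).2 rfl⟩⟩⟩)
  obtain ⟨Δ, hΔ, hR, h⟩ := hΓ.dia_mem_iff.1 hdia
  obtain ⟨hK, hhat⟩ := hΔ.mem_and.1 h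
  rw [hΔ.mem_bigAnd] at hhat
  simp only [List.mem_map, forall_exists_index, and_imp, forall_apply_eq_imp_iff₂, hlmem] at hhat
  refine ⟨Δ, hΔ, hR, Set.Subset.antisymm (fun t ht => ?_) fun t ht => ⟨(hT ht).1, hhat t ht⟩⟩
  obtain ⟨Θ, hΘ, hR', rfl⟩ := hΔ.mem_possibleTypes.1 ht
  exact (hdisj hΘ).1 (hR' _ hK)

end Types

/-! ### The truth lemma -/

section TruthLemma

variable {P : Type v} {Q : Finset P}

/-- A complete theory describes a pointed model, as far as the letters in `Q` are concerned. -/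
def Describes (Q : Finset P) (Γ : Set (Form P)) (M : Model.{u, v} P) (w : M.World) : Prop :=
  IsComplete Γ ∧ M.trace Q w = trace Q Γ ∧ Set.range (M.trace Q) = possibleTypes Q Γ

/-- The truth value of `φ` at a pointed model can be read off from any theory describing it. -/
def Determined (Q : Finset P) (φ : Form P) : Prop :=
  ∀ (Γ : Set (Form P)) (M : Model.{u, v} P) (w : M.World), Describes Q Γ M w →
    (Sat M w φ ↔ φ ∈ Γ)

variable {φ ψ : Form P}

theorem Determined.atom {p : P} (hp : p ∈ Q) : Determined.{u} Q (.atom p) := by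
  rintro Γ M w ⟨-, h, -⟩
  have := Set.ext_iff.1 h p
  simp only [Model.trace, trace, Set.mem_ofPred_eq, hp, true_and] at this
  exact this

theorem Determined.bot : Determined.{u} Q (.bot : Form P) :=
  fun _ _ _ h => iff_of_false id h.1.bot_notMem

theorem Determined.and (hφ : Determined.{u} Q φ) (hψ : Determined.{u} Q ψ) :
    Determined.{u} Q (.and φ ψ) := fun Γ M w h => by
  rw [h.1.mem_and, ← hφ Γ M w h, ← hψ Γ M w h, Sat]

theorem Determined.or (hφ : Determined.{u} Q φ) (hψ : Determined.{u} Q ψ) :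
    Determined.{u} Q (.or φ ψ) := fun Γ M w h => by
  rw [h.1.mem_or, ← hφ Γ M w h, ← hψ Γ M w h, Sat]

theorem Determined.imp (hφ : Determined.{u} Q φ) (hψ : Determined.{u} Q ψ) :
    Determined.{u} Q (.imp φ ψ) := fun Γ M w h => by
  rw [h.1.mem_imp, ← hφ Γ M w h, ← hψ Γ M w h, Sat]

theorem Determined.know (hφ : Determined.{u} Q φ) : Determined.{u} Q (.know φ) := by
  rintro Γ M w ⟨hΓ, -, hT⟩
  have hdesc : ∀ Δ v, IsComplete Δ → KRel Γ Δ → M.trace Q v = trace Q Δ → Describes Q Δ M v :=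
    fun Δ v hΔ hR hv => ⟨hΔ, hv, hT.trans (hR.possibleTypes_eq hΓ hΔ).symm⟩
  rw [hΓ.know_mem_iff, Sat]
  constructor
  · intro h Δ hΔ hR
    obtain ⟨v, hv⟩ := hT.ge (hΓ.mem_possibleTypes.2 ⟨Δ, hΔ, hR, rfl⟩)
    exact (hφ Δ M v (hdesc Δ v hΔ hR hv)).1 (h v)
  · intro h v
    obtain ⟨Δ, hΔ, hR, hv⟩ := hΓ.mem_possibleTypes.1 (hT.le ⟨v, rfl⟩)
    exact (hφ Δ M v (hdesc Δ v hΔ hR hv.symm)).2 (h Δ hΔ hR)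

theorem Model.range_trace_restrict (M : Model.{u, v} P) (s : Set M.World) (hs : s.Nonempty) :
    Set.range ((M.restrict s hs).trace Q) = M.trace Q '' s := by
  ext t
  exact ⟨fun ⟨v, hv⟩ => ⟨v.1, v.2, hv⟩, fun ⟨v, hv, h⟩ => ⟨⟨v, hv⟩, h⟩⟩

theorem Determined.box (hφ : Determined.{u} Q φ) : Determined.{u} Q (.box φ) := by
  rintro Γ M w ⟨hΓ, hw, hT⟩
  rw [hΓ.box_mem_iff, Sat]
  constructor
  · intro h Δ hΔ hR
    -- The submodel matching `Δ` consists of all worlds whose type `Δ` considers possible.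
    have hws : w ∈ M.trace Q ⁻¹' possibleTypes Q Δ := by
      rw [Set.mem_preimage, hw, ← hR.trace_eq hΓ hΔ]
      exact hΔ.trace_mem_possibleTypes
    refine (hφ Δ (M.restrict _ ⟨w, hws⟩) ⟨w, hws⟩
      ⟨hΔ, hw.trans (hR.trace_eq hΓ hΔ).symm, ?_⟩).1 (h _ hws)
    rw [Model.range_trace_restrict _ _ ⟨w, hws⟩, Set.image_preimage_eq_of_subset]
    exact (hR.possibleTypes_subset hΓ hΔ).trans hT.ge
  · intro h s hs
    obtain ⟨Δ, hΔ, hR, hTΔ⟩ := hΓ.exists_boxRel (T := M.trace Q '' s)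
      ((Set.image_subset_range _ _).trans hT.le) ⟨w, hs, hw⟩
    refine (hφ Δ (M.restrict s ⟨w, hs⟩) ⟨w, hs⟩
      ⟨hΔ, hw.trans (hR.trace_eq hΓ hΔ).symm, ?_⟩).2 (h Δ hΔ hR)
    rw [Model.range_trace_restrict _ _ ⟨w, hs⟩, hTΔ]

theorem Determined.congr (hφ : Determined.{u} Q φ) (hprov : Provable (iff ψ φ))
    (hsat : ∀ (M : Model.{u, v} P) (w : M.World), Sat M w ψ ↔ Sat M w φ) :
    Determined.{u} Q ψ := fun Γ M w h => by
  rw [hsat, hφ Γ M w h, h.1.mem_congr hprov]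

instance PForm.instNonemptyResSpace (α : PForm P) : Nonempty α.ResSpace := by
  induction α with
  | atom p => exact ⟨⟨p, rfl⟩⟩
  | bot => exact ⟨PUnit.unit⟩
  | and α β hα hβ => exact hα.elim fun x => hβ.elim fun y => ⟨(x, y)⟩
  | or α β hα hβ => exact hα.elim fun x => ⟨Sum.inl x⟩
  | imp α β hα hβ => exact hβ.elim fun y => ⟨fun _ => y⟩

/-! ### Resolutions and the reduction of `Kh` -/

section Resolutions

variable (M : Model.{u, v} P) (w : M.World)

theorem Model.res_restrict (s : Set M.World) (hs : s.Nonempty) (v : s) (α : PForm P) :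
    (M.restrict s hs).res v α = M.res v.1 α := by
  induction α <;> simp_all [Model.res]

theorem sat_kh_atom (p : P) : Sat M w (.kh (.atom p)) ↔ Sat M w (.know (.atom p)) :=
  ⟨fun ⟨_, hx⟩ v => hx v, fun h => ⟨⟨p, rfl⟩, h⟩⟩

theorem not_sat_kh_bot : ¬ Sat M w (.kh .bot) := fun ⟨_, hx⟩ => hx w

theorem sat_kh_or (α β : PForm P) :
    Sat M w (.kh (.or α β)) ↔ Sat M w (.or (.kh α) (.kh β)) := by
  simp [Sat, Model.res]

theorem sat_kh_and (α β : PForm P) :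
    Sat M w (.kh (.and α β)) ↔ Sat M w (.and (.kh α) (.kh β)) := by
  simp [Sat, Model.res, forall_and]

/-- A uniform resolution of the implication is a choice, for each `x`, of one `y` that resolves `β`
wherever `x` resolves `α`. The worlds where `x` resolves `α` form a submodel satisfying `Kh α`, if
there are any, and `Kh β` there supplies `y`. -/
theorem sat_kh_imp (α β : PForm P) :
    Sat M w (.kh (.imp α β)) ↔ Sat M w (.know (.box (.imp (.kh α) (.kh β)))) := by
  constructor
  · rintro ⟨f, hf⟩ v s hs ⟨x, hx⟩
    refine ⟨f x, fun z => ?_⟩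
    have hz := hx z
    rw [Model.res_restrict] at hz ⊢
    exact hf z.1 ⟨x, hz, rfl⟩
  · intro h
    have key : ∀ x : α.ResSpace, ∃ y : β.ResSpace, ∀ v, x ∈ M.res v α → y ∈ M.res v β := by
      intro x
      by_cases hne : ∃ v, x ∈ M.res v α
      · obtain ⟨v, hv⟩ := hne
        obtain ⟨y, hy⟩ := h v {z | x ∈ M.res z α} hv ⟨x, fun z => by
          rw [Model.res_restrict]
          exact z.2⟩
        refine ⟨y, fun z hz => ?_⟩
        have := hy ⟨z, hz⟩
        rwa [Model.res_restrict] at this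
      -- When `x` resolves `α` nowhere, any element of the non-empty resolution space will do.
      · exact ⟨Classical.arbitrary _, fun v hv => (hne ⟨v, hv⟩).elim⟩
    choose f hf using key
    refine ⟨f, fun v => ?_⟩
    rintro _ ⟨x, hx, rfl⟩
    exact hf x v hx

end Resolutions

theorem Provable.iff_intro (h₁ : Provable (.imp φ ψ)) (h₂ : Provable (.imp ψ φ)) :
    Provable (iff φ ψ) :=
  isTheory_provable.mem_and.2 ⟨h₁, h₂⟩

theorem Determined.kh {α : PForm P} (hα : α.letters ⊆ Q) : Determined.{u} Q (.kh α) := by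
  induction α with
  | atom p =>
    exact (Determined.atom (hα rfl)).know.congr (.iff_intro (.khK (.atom p)) (.kKhp p))
      fun M w => sat_kh_atom M w p
  | bot => exact Determined.bot.congr .khBot fun M w => iff_of_false (not_sat_kh_bot M w) id
  | and α β ihα ihβ =>
    obtain ⟨h₁, h₂⟩ := Set.union_subset_iff.1 hα
    exact ((ihα h₁).and (ihβ h₂)).congr (.khAnd α β) fun M w => sat_kh_and M w α β
  | or α β ihα ihβ =>
    obtain ⟨h₁, h₂⟩ := Set.union_subset_iff.1 hα
    exact ((ihα h₁).or (ihβ h₂)).congr (.khOr α β) fun M w => sat_kh_or M w α β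
  | imp α β ihα ihβ =>
    obtain ⟨h₁, h₂⟩ := Set.union_subset_iff.1 hα
    exact ((ihα h₁).imp (ihβ h₂)).box.know.congr (.khImp α β) fun M w => sat_kh_imp M w α β

/-- The truth lemma. -/
theorem determined_of_letters_subset (hφ : φ.letters ⊆ Q) : Determined.{u} Q φ := by
  induction φ with
  | atom p => exact .atom (hφ rfl)
  | bot => exact .bot
  | and φ ψ ihφ ihψ =>
    obtain ⟨h₁, h₂⟩ := Set.union_subset_iff.1 hφ
    exact (ihφ h₁).and (ihψ h₂)
  | or φ ψ ihφ ihψ =>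
    obtain ⟨h₁, h₂⟩ := Set.union_subset_iff.1 hφ
    exact (ihφ h₁).or (ihψ h₂)
  | imp φ ψ ihφ ihψ =>
    obtain ⟨h₁, h₂⟩ := Set.union_subset_iff.1 hφ
    exact (ihφ h₁).imp (ihψ h₂)
  | know φ ih => exact (ih hφ).know
  | kh α => exact .kh hφ
  | box φ ih => exact (ih hφ).box

/-- Every complete theory describes a pointed model, in any universe. -/
theorem IsComplete.exists_describes {Γ : Set (Form P)} (hΓ : IsComplete Γ) (Q : Finset P) :
    ∃ (M : Model.{u, v} P) (w : M.World), Describes Q Γ M w := by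
  -- Finiteness makes the set of types small, so a copy of it can serve as the worlds in universe
  -- `u`.
  have : Finite (possibleTypes Q Γ) := finite_possibleTypes
  let e := equivShrink.{u} (possibleTypes Q Γ)
  have hsub : ∀ t ∈ possibleTypes Q Γ, {p | p ∈ Q ∧ p ∈ t} = t :=
    fun t ht => Set.ext fun p => ⟨fun hp => hp.2, fun hp => ⟨ht.1 hp, hp⟩⟩
  refine ⟨⟨Shrink.{u} (possibleTypes Q Γ), ⟨e ⟨_, hΓ.trace_mem_possibleTypes⟩⟩,
    fun w => (e.symm w).1⟩, e ⟨_, hΓ.trace_mem_possibleTypes⟩, hΓ, ?_, ?_⟩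
  · simp only [Model.trace, Equiv.symm_apply_apply]
    exact hsub _ hΓ.trace_mem_possibleTypes
  · ext t
    constructor
    · rintro ⟨w, rfl⟩
      exact Set.mem_of_eq_of_mem (hsub _ (e.symm w).2) (e.symm w).2
    · intro ht
      exact ⟨e ⟨t, ht⟩, by
        simp only [Model.trace, Equiv.symm_apply_apply]
        exact hsub t ht⟩

end TruthLemma

end InqKh

theorem mainTheorem3 {P : Type v} [Countable P] (φ : InqKh.Form P)
    (h : InqKh.Valid.{u, v} φ) : InqKh.Provable φ := by
  refine InqKh.provable_of_forall_mem fun Γ hΓ => ?_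
  obtain ⟨M, w, hM⟩ := hΓ.exists_describes.{u, v} φ.finite_letters.toFinset
  exact (InqKh.determined_of_letters_subset (by simp) Γ M w hM).1 (h M w)
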